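/- Notation. All matrices are complex; $M^*$ is the conjugate transpose, $\mathcal R(M)$ and $\mathcal N(M)$ are the range (column space) and the null space of $M$, $M^\dagger$ is the Moore-Penrose inverse, and $P_M:=MM^\dagger$. For $A\in\mathbb C^{n\times n}$ the index $\mathrm{Ind}(A)$ is the smallest integer $k\ge 0$ with $\mathrm{rk}(A^k)=\mathrm{rk}(A^{k+1})$. With $k=\mathrm{Ind}(A)$, the Drazin inverse $A^d$ is the unique matrix $X$ with $XAX=X$, $AX=XA$, $XA^{k+1}=A^k$; the core EP inverse is $A^{c}:=A^k(A^{k+1})^\dagger$; the DMP inverse is $A^{d,\dagger}:=A^dP_A$; the weak group inverse is $A^{w}:=(A^{c})^2A$; and the weak core (WC) inverse is $A^{w,\dagger}:=A^{w}P_A$. The matrix $A$ is called $k$-WC if $A^kA^{w,\dagger}=A^{w,\dagger}A^k$, $k$-DMP if $A^kA^{d,\dagger}=A^{d,\dagger}A^k$, and WC if $A^{w,\dagger}=A^{d,\dagger}$. Theorem. Let $A\in\mathbb C^{n\times n}$ with $\mathrm{Ind}(A)=k\ge 1$ be written in a core EP decomposition $$A=U\begin{bmatrix}T&S\\0&N\end{bmatrix}U^*,$$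 where $U\in\mathbb C^{n\times n}$ is unitary, $T\in\mathbb C^{t\times t}$ is nonsingular, and $N\in\mathbb C^{(n-t)\times(n-t)}$ is nilpotent of index $k$ (here $0\le t<n$). Put $\tilde T_k:=\sum_{i=0}^{k-1}T^iSN^{k-1-i}$. Then the following conditions are equivalent: (a) $A$ is a $k$-WC matrix; (b) $A^mA^{w,\dagger}=A^{w,\dagger}A^m$ for all positive integers $m$; (c) $A^mA^{w,\dagger}=A^{w,\dagger}A^m$ for some positive integer $m$; (d) $A^{w,\dagger}=A^d$; (e) $A$ is both a WC matrix and a $k$-DMP matrix; (f) $\mathcal R(N^2)\subseteq\mathcal N(S)$ and $\mathcal N(N^*)\subseteq\mathcal N(\tilde T_k)$; (g) $SN+TS(I_{n-t}-P_N)=0$. -/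

import Mathlib

open scoped Matrix

namespace WeakCore

section MoorePenrose

variable {m n : Type*} [Fintype m] [Fintype n]

/-- The four Penrose equations: `X` is a Moore-Penrose inverse of `A`. -/
structure IsMoorePenrose (A : Matrix m n ℂ) (X : Matrix n m ℂ) : Prop where
  inner : A * X * A = A
  outer : X * A * X = X
  left_herm : (A * X)ᴴ = A * X
  right_herm : (X * A)ᴴ = X * A

theorem IsMoorePenrose.unique {A : Matrix m n ℂ} {X Y : Matrix n m ℂ}
    (hX : IsMoorePenrose A X) (hY : IsMoorePenrose A Y) : X = Y := by
  have h1 : A * X = A * Y := by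
    calc A * X = (A * X)ᴴ := hX.left_herm.symm
      _ = ((A * Y) * (A * X))ᴴ := by
          rw [← Matrix.mul_assoc, hY.inner]
      _ = (A * X) * (A * Y) := by
          rw [Matrix.conjTranspose_mul, hX.left_herm, hY.left_herm]
      _ = A * Y := by rw [← Matrix.mul_assoc, hX.inner]
  have h2 : X * A = Y * A := by
    calc X * A = (X * A)ᴴ := hX.right_herm.symm
      _ = ((X * A) * (Y * A))ᴴ := by
          rw [Matrix.mul_assoc X A, ← Matrix.mul_assoc A Y, hY.inner]
      _ = (Y * A) * (X * A) := by
          rw [Matrix.conjTranspose_mul, hX.right_herm, hY.right_herm]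
      _ = Y * A := by rw [Matrix.mul_assoc Y A, ← Matrix.mul_assoc A X, hX.inner]
  calc X = X * A * X := hX.outer.symm
    _ = Y * (A * Y) := by rw [h2, Matrix.mul_assoc, h1]
    _ = Y := by rw [← Matrix.mul_assoc, hY.outer]

/-- A Hermitian matrix has a Hermitian commuting reflexive generalized inverse. -/
theorem exists_herm_ginv (H : Matrix n n ℂ) (hH : H.IsHermitian) :
    ∃ G : Matrix n n ℂ, Gᴴ = G ∧ G * H = H * G ∧ H * G * H = H ∧ G * H * G = G := by
  classical
  set U : Matrix n n ℂ := (hH.eigenvectorUnitary : Matrix n n ℂ) with hU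
  set d : n → ℂ := fun i => (hH.eigenvalues i : ℂ) with hd
  have hUU : Uᴴ * U = 1 := Unitary.coe_star_mul_self hH.eigenvectorUnitary
  have hs : H = U * Matrix.diagonal d * Uᴴ := by
    have := hH.spectral_theorem
    rw [Unitary.conjStarAlgAut_apply] at this
    exact this
  have key : ∀ e f : n → ℂ, (U * Matrix.diagonal e * Uᴴ) * (U * Matrix.diagonal f * Uᴴ)
      = U * Matrix.diagonal (fun i => e i * f i) * Uᴴ := by
    intro e f
    rw [← Matrix.diagonal_mul_diagonal]
    calc _ = U * Matrix.diagonal e * (Uᴴ * U) * Matrix.diagonal f * Uᴴ := by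
          simp only [Matrix.mul_assoc]
      _ = _ := by rw [hUU]; simp only [Matrix.mul_assoc, Matrix.one_mul]
  refine ⟨U * Matrix.diagonal (fun i => (d i)⁻¹) * Uᴴ, ?_, ?_, ?_, ?_⟩
  · rw [Matrix.conjTranspose_mul, Matrix.conjTranspose_mul, Matrix.conjTranspose_conjTranspose,
      Matrix.diagonal_conjTranspose, Matrix.mul_assoc]
    congr 3
    ext i
    simp [hd]
  · rw [hs, key, key]
    simp only [mul_comm]
  · rw [hs, key, key]
    congr 3
    ext i
    by_cases h : d i = 0 <;> simp [h]
  · rw [hs, key, key]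
    congr 3
    ext i
    by_cases h : d i = 0 <;> simp [h]

open scoped ComplexOrder in
theorem exists_isMoorePenrose (A : Matrix m n ℂ) : ∃ X, IsMoorePenrose A X := by
  obtain ⟨G, hG, hc, h1, h2⟩ :=
    exists_herm_ginv (Aᴴ * A) (Matrix.isHermitian_conjTranspose_mul_self A)
  have hc' : G * Aᴴ * A = Aᴴ * A * G := by rw [Matrix.mul_assoc]; exact hc
  refine ⟨G * Aᴴ, ?_, ?_, ?_, ?_⟩
  · rw [← sub_eq_zero, ← Matrix.conjTranspose_mul_self_eq_zero]
    have e : A * (G * Aᴴ) * A = A * (G * (Aᴴ * A)) := by simp only [Matrix.mul_assoc]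
    have e2 : Aᴴ * (A * (G * (Aᴴ * A)) - A) = 0 := by
      rw [Matrix.mul_sub, ← Matrix.mul_assoc, ← Matrix.mul_assoc, h1, sub_self]
    rw [e]
    have e3 : (A * (G * (Aᴴ * A)) - A)ᴴ = (G * (Aᴴ * A))ᴴ * Aᴴ - Aᴴ := by
      rw [Matrix.conjTranspose_sub, Matrix.conjTranspose_mul]
    rw [e3, Matrix.sub_mul, Matrix.mul_assoc, e2, Matrix.mul_zero, sub_zero]
  · calc G * Aᴴ * A * (G * Aᴴ) = G * (Aᴴ * A) * G * Aᴴ := by simp only [Matrix.mul_assoc]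
      _ = G * Aᴴ := by rw [h2]
  · rw [Matrix.conjTranspose_mul, Matrix.conjTranspose_mul, hG,
      Matrix.conjTranspose_conjTranspose, Matrix.mul_assoc]
  · rw [Matrix.conjTranspose_mul, Matrix.conjTranspose_mul, hG,
      Matrix.conjTranspose_conjTranspose, hc', Matrix.mul_assoc]

/-- The Moore-Penrose inverse `A†`. -/
noncomputable def pinv (A : Matrix m n ℂ) : Matrix n m ℂ :=
  Classical.choose (exists_isMoorePenrose A)

theorem pinv_spec (A : Matrix m n ℂ) : IsMoorePenrose A (pinv A) :=
  Classical.choose_spec (exists_isMoorePenrose A)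

/-- The orthogonal projector `P_A = A A†` onto the range of `A`. -/
noncomputable def projRange (A : Matrix m n ℂ) : Matrix m m ℂ := A * pinv A

end MoorePenrose

section Square

variable {n : Type*} [Fintype n] [DecidableEq n]

/-- The index `Ind(A)`: the smallest `k ≥ 0` with `rk(A^k) = rk(A^(k+1))`. -/
noncomputable def ind (A : Matrix n n ℂ) : ℕ := sInf {k : ℕ | (A ^ k).rank = (A ^ (k + 1)).rank}

theorem ind_spec (A : Matrix n n ℂ) : (A ^ ind A).rank = (A ^ (ind A + 1)).rank := by
  have hne : {k : ℕ | (A ^ k).rank = (A ^ (k + 1)).rank}.Nonempty := by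
    by_contra h
    have hlt : ∀ k, (A ^ (k + 1)).rank < (A ^ k).rank := by
      intro k
      refine lt_of_le_of_ne ?_ fun e => h ⟨k, e.symm⟩
      rw [pow_succ]
      exact Matrix.rank_mul_le_left _ _
    have hb : ∀ k, (A ^ k).rank + k ≤ (A ^ 0).rank := by
      intro k
      induction k with
      | zero => simp
      | succ k ih => have := hlt k; omega
    have := hb ((A ^ 0).rank + 1)
    omega
  exact Nat.sInf_mem hne

/-- `X` is a Drazin inverse of `A`. -/
structure IsDrazin (A X : Matrix n n ℂ) : Prop where
  outer : X * A * X = X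
  comm : A * X = X * A
  pow : X * A ^ (ind A + 1) = A ^ ind A

theorem IsDrazin.unique {A X Y : Matrix n n ℂ} (hX : IsDrazin A X) (hY : IsDrazin A Y) :
    X = Y := by
  have aux : ∀ {Z : Matrix n n ℂ}, IsDrazin A Z → ∀ j, Z = Z ^ (j + 1) * A ^ j := by
    intro Z hZ j
    have hc : Commute A Z := hZ.comm
    induction j with
    | zero => simp
    | succ j ih =>
      have h2 : Z = Z * Z * A := by
        conv_lhs => rw [← hZ.outer]
        rw [mul_assoc, hZ.comm, ← mul_assoc]
      calc Z = Z ^ (j + 1) * A ^ j := ih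
        _ = Z ^ j * Z * A ^ j := by rw [pow_succ]
        _ = Z ^ j * (Z * Z * A) * A ^ j := by rw [← h2]
        _ = Z ^ (j + 1 + 1) * A ^ (j + 1) := by
            rw [pow_succ Z (j + 1), pow_succ Z j, pow_succ' A j]
            simp only [mul_assoc]
  set k := ind A with hk
  have hcX : Commute A X := hX.comm
  have hcY : Commute A Y := hY.comm
  have e1 : X = X * A * Y := by
    calc X = X ^ (k + 1) * A ^ k := aux hX k
      _ = X ^ (k + 1) * (Y * A ^ (k + 1)) := by rw [hY.pow]
      _ = X ^ (k + 1) * (A ^ (k + 1) * Y) := by rw [(hcY.pow_left (k + 1)).eq]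
      _ = X ^ (k + 1) * A ^ k * A * Y := by rw [pow_succ A k]; simp only [mul_assoc]
      _ = X * A * Y := by rw [← aux hX k]
  have e2 : Y = X * A * Y := by
    calc Y = Y ^ (k + 1) * A ^ k := aux hY k
      _ = A ^ k * Y ^ (k + 1) := ((hcY.pow_pow k (k + 1)).eq).symm
      _ = X * A ^ (k + 1) * Y ^ (k + 1) := by rw [hX.pow]
      _ = X * A * (A ^ k * Y ^ (k + 1)) := by rw [pow_succ' A k]; simp only [mul_assoc]
      _ = X * A * (Y ^ (k + 1) * A ^ k) := by rw [(hcY.pow_pow k (k + 1)).eq]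
      _ = X * A * Y := by rw [← aux hY k]
  rw [e1, ← e2]

/-- If right multiplication by `C` does not lower the rank of `B`, it can be undone. -/
theorem exists_right_factor {B C : Matrix n n ℂ} (h : B.rank = (B * C).rank) :
    ∃ W, B = B * C * W := by
  have hle : LinearMap.range (B * C).mulVecLin ≤ LinearMap.range B.mulVecLin := by
    rw [Matrix.mulVecLin_mul]
    exact LinearMap.range_comp_le_range _ _
  have heq : LinearMap.range (B * C).mulVecLin = LinearMap.range B.mulVecLin :=
    Submodule.eq_of_le_of_finrank_eq hle h.symm
  have hx : ∀ j : n, ∃ w : n → ℂ, (B * C) *ᵥ w = B *ᵥ Pi.single j 1 := by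
    intro j
    have : B.mulVecLin (Pi.single j 1) ∈ LinearMap.range (B * C).mulVecLin := by
      rw [heq]; exact ⟨_, rfl⟩
    exact this
  choose w hw using hx
  refine ⟨Matrix.of fun i j => w j i, ?_⟩
  ext i j
  have := congrFun (hw j) i
  rw [Matrix.mulVec_single_one] at this
  rw [Matrix.mul_apply]
  exact this.symm

theorem exists_isDrazin (A : Matrix n n ℂ) : ∃ X, IsDrazin A X := by
  set k := ind A with hk
  have right : ∀ B : Matrix n n ℂ, (B ^ k).rank = (B ^ (k + 1)).rank →
      ∀ j, ∃ W, B ^ k = B ^ (k + j) * W := by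
    intro B hB j
    obtain ⟨W, hW⟩ := exists_right_factor (B := B ^ k) (C := B) (by rw [hB, pow_succ])
    induction j with
    | zero => exact ⟨1, by simp⟩
    | succ j ih =>
      obtain ⟨V, hV⟩ := ih
      refine ⟨W * V, ?_⟩
      calc B ^ k = B ^ (k + j) * V := hV
        _ = B ^ j * B ^ k * V := by rw [← pow_add, add_comm j k]
        _ = B ^ j * (B ^ k * B * W) * V := by rw [← hW]
        _ = (B ^ j * B ^ k * B) * (W * V) := by simp only [mul_assoc]
        _ = B ^ (k + (j + 1)) * (W * V) := by
            rw [← pow_add, ← pow_succ]; congr 2; omega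
  obtain ⟨Y, hY⟩ := right A (ind_spec A) (k + 1)
  obtain ⟨Z', hZ'⟩ := right Aᵀ (by
    rw [← Matrix.transpose_pow, ← Matrix.transpose_pow, Matrix.rank_transpose,
      Matrix.rank_transpose]
    exact ind_spec A) (k + 1)
  have hZ : A ^ k = Z'ᵀ * A ^ (k + (k + 1)) := by
    have := congrArg Matrix.transpose hZ'
    rwa [Matrix.transpose_mul, ← Matrix.transpose_pow, ← Matrix.transpose_pow,
      Matrix.transpose_transpose, Matrix.transpose_transpose] at this
  set Z := Z'ᵀ
  have hM : A ^ (k + (k + 1)) = A ^ k * A ^ (k + 1) := pow_add _ _ _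
  have hM' : A ^ (k + (k + 1)) = A ^ (k + 1) * A ^ k := by rw [add_comm, pow_add]
  have hX : Z * A ^ k = A ^ k * Y := by
    calc Z * A ^ k = Z * (A ^ (k + (k + 1)) * Y) := by rw [← hY]
      _ = A ^ k * Y := by rw [← mul_assoc, ← hZ]
  have hAX : Z * A ^ (k + 1) = A ^ (k + 1) * Y := by
    calc Z * A ^ (k + 1) = Z * (A * A ^ k) := by rw [pow_succ']
      _ = Z * (A * (A ^ (k + (k + 1)) * Y)) := by rw [← hY]
      _ = Z * A ^ (k + (k + 1)) * A * Y := by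
          rw [← mul_assoc A, ← pow_succ', pow_succ]; simp only [mul_assoc]
      _ = A ^ (k + 1) * Y := by rw [← hZ, pow_succ]
  refine ⟨A ^ k * Y, ?_, ?_, ?_⟩
  · calc A ^ k * Y * A * (A ^ k * Y) = Z * A ^ k * A * (A ^ k * Y) := by rw [hX]
      _ = Z * (A ^ (k + 1) * A ^ k) * Y := by rw [pow_succ]; simp only [mul_assoc]
      _ = A ^ k * Y := by rw [← hM', ← hZ]
  · rw [← mul_assoc, ← pow_succ', ← hAX, ← hX, mul_assoc, ← pow_succ]
  · rw [← hX, mul_assoc, ← hk, ← hM, ← hZ]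

/-- The Drazin inverse `A^d`. -/
noncomputable def drazin (A : Matrix n n ℂ) : Matrix n n ℂ := Classical.choose (exists_isDrazin A)

theorem drazin_spec (A : Matrix n n ℂ) : IsDrazin A (drazin A) :=
  Classical.choose_spec (exists_isDrazin A)

/-- The core EP inverse `A^k (A^(k+1))†`, where `k = Ind(A)`. -/
noncomputable def coreEP (A : Matrix n n ℂ) : Matrix n n ℂ :=
  A ^ ind A * pinv (A ^ (ind A + 1))

/-- The DMP inverse `A^d P_A`. -/
noncomputable def dmp (A : Matrix n n ℂ) : Matrix n n ℂ := drazin A * projRange A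

/-- The weak group (WG) inverse: the square of the core EP inverse, times `A`. -/
noncomputable def weakGroup (A : Matrix n n ℂ) : Matrix n n ℂ := coreEP A ^ 2 * A

/-- The weak core (WC) inverse: the WG inverse times `P_A`. -/
noncomputable def weakCore (A : Matrix n n ℂ) : Matrix n n ℂ := weakGroup A * projRange A

/-- `A` is a `k`-WC matrix, where `k = Ind(A)`. -/
def IsKWC (A : Matrix n n ℂ) : Prop := A ^ ind A * weakCore A = weakCore A * A ^ ind A

/-- `A` is a `k`-DMP matrix, where `k = Ind(A)`. -/
def IsKDMP (A : Matrix n n ℂ) : Prop := A ^ ind A * dmp A = dmp A * A ^ ind A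

/-- `A` is a weak core (WC) matrix: its WC inverse and its DMP inverse coincide. -/
def IsWC (A : Matrix n n ℂ) : Prop := weakCore A = dmp A

end Square

section Decomposition

/-- The identification of `{0, …, t-1} ⊔ {0, …, n-t-1}` with `{0, …, n-1}` that lists the first
block before the second. -/
def blockEquiv {n t : ℕ} (ht : t ≤ n) : Fin t ⊕ Fin (n - t) ≃ Fin n :=
  finSumFinEquiv.trans (finCongr (Nat.add_sub_of_le ht))

/-- The `n × n` block upper triangular matrix `[T S; 0 N]`. -/
def blockUpper {n t : ℕ} (ht : t ≤ n) (T : Matrix (Fin t) (Fin t) ℂ)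
    (S : Matrix (Fin t) (Fin (n - t)) ℂ) (N : Matrix (Fin (n - t)) (Fin (n - t)) ℂ) :
    Matrix (Fin n) (Fin n) ℂ :=
  Matrix.reindex (blockEquiv ht) (blockEquiv ht) (Matrix.fromBlocks T S 0 N)

/-- `A = U [T S; 0 N] U*` is a core EP decomposition of the matrix `A` of index `k`. -/
structure IsCoreEPDecomposition {n t : ℕ} (ht : t ≤ n) (k : ℕ) (A U : Matrix (Fin n) (Fin n) ℂ)
    (T : Matrix (Fin t) (Fin t) ℂ) (S : Matrix (Fin t) (Fin (n - t)) ℂ)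
    (N : Matrix (Fin (n - t)) (Fin (n - t)) ℂ) : Prop where
  unitary : U ∈ Matrix.unitaryGroup (Fin n) ℂ
  nonsingular : IsUnit T
  nilpotent : IsNilpotent N
  nilpotent_index : nilpotencyClass N = k
  eq : A = U * blockUpper ht T S N * Uᴴ

/-- `T̃_m = ∑_{i=0}^{m-1} T^i S N^(m-1-i)`. -/
def tTilde {t s : ℕ} (T : Matrix (Fin t) (Fin t) ℂ) (S : Matrix (Fin t) (Fin s) ℂ)
    (N : Matrix (Fin s) (Fin s) ℂ) (m : ℕ) : Matrix (Fin t) (Fin s) ℂ :=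
  ∑ i ∈ Finset.range m, T ^ i * S * N ^ (m - 1 - i)

end Decomposition

end WeakCore

open WeakCore

/-! Reindexing and conjugation by `U` form a star-algebra isomorphism `φ`, so Moore-Penrose
projectors can be computed on blocks. With `V` the inverse of `T`, the WC inverse of `A` is the
image of `[V, V²SP_N; 0, 0]` (`weakCore_block`). It commutes with `A ^ m`, `m ≥ 1`, exactly when
`T^m S P_N = T̃_(m+1)` (`pow_mul_weakCore_block_iff`). Both this equation and (g) force `S N² = 0`:
(g) after multiplication by `N`, the equation by a descent along the nilpotency of `N`. Then
`T̃_(m+1)` collapses to `T^(m-1)(TS + SN)`, and cancelling `T^(m-1)` turns the equation into (g),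
whatever `m` is (`tTilde_comm_iff`). Condition (f) reduces to (g) by the same collapse
(`tTilde_null_iff`). -/

namespace WeakCore

/-! ### Orthogonal projectors and subspace inclusions. -/

section MoorePenrose

variable {m n : Type*} [Fintype m] [Fintype n]

theorem projRange_mul_self (A : Matrix m n ℂ) : projRange A * A = A := (pinv_spec A).inner

theorem projRange_herm (A : Matrix m n ℂ) : (projRange A)ᴴ = projRange A :=
  (pinv_spec A).left_herm

theorem projRange_idem (A : Matrix m n ℂ) : projRange A * projRange A = projRange A := by
  unfold projRange
  rw [← Matrix.mul_assoc, (pinv_spec A).inner]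

/-- The orthogonal projector onto the range of `A` is the only Hermitian matrix `Q = A * Y`
with `Q * A = A`. -/
theorem eq_projRange {A : Matrix m n ℂ} {Q : Matrix m m ℂ} {Y : Matrix n m ℂ} (hQ : Qᴴ = Q)
    (hQA : Q * A = A) (hY : Q = A * Y) : projRange A = Q := by
  have h1 : projRange A * Q = Q := by
    rw [hY, ← Matrix.mul_assoc, projRange_mul_self]
  have h2 : Q * projRange A = projRange A := by
    unfold projRange
    rw [← Matrix.mul_assoc, hQA]
  have h3 := congrArg Matrix.conjTranspose h1
  rw [Matrix.conjTranspose_mul, hQ, projRange_herm, h2] at h3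
  exact h3

/-- `R(A) ⊆ N(B)` means `B * A = 0`. -/
theorem range_le_ker_iff {l : Type*} {A : Matrix m n ℂ} {B : Matrix l m ℂ} :
    LinearMap.range A.mulVecLin ≤ LinearMap.ker B.mulVecLin ↔ B * A = 0 := by
  classical
  rw [LinearMap.range_le_ker_iff, ← Matrix.mulVecLin_mul, ← Matrix.mulVecLin_zero]
  refine ⟨fun h => ?_, fun h => by rw [h]⟩
  ext i j
  have := congrFun (LinearMap.congr_fun h (Pi.single j 1)) i
  rw [Matrix.mulVecLin_apply, Matrix.mulVec_single_one] at this
  simpa using this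

/-- `N(A*) ⊆ N(B)` means that `B` vanishes on the orthogonal complement of the range of `A`. -/
theorem ker_conjTranspose_le_ker_iff {l : Type*} [DecidableEq m] {A : Matrix m n ℂ}
    {B : Matrix l m ℂ} :
    LinearMap.ker Aᴴ.mulVecLin ≤ LinearMap.ker B.mulVecLin ↔ B * (1 - projRange A) = 0 := by
  -- The orthogonal complement of the range of `A` is the range of `1 - P_A`.
  have hker : LinearMap.ker Aᴴ.mulVecLin = LinearMap.range (1 - projRange A).mulVecLin := by
    apply le_antisymm
    · intro x hx
      have hx' : Aᴴ *ᵥ x = 0 := hx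
      have hP : projRange A = (pinv A)ᴴ * Aᴴ := by
        rw [← Matrix.conjTranspose_mul]
        exact (projRange_herm A).symm
      refine ⟨x, ?_⟩
      rw [Matrix.mulVecLin_apply, Matrix.sub_mulVec, Matrix.one_mulVec, hP,
        ← Matrix.mulVec_mulVec, hx', Matrix.mulVec_zero, sub_zero]
    · rw [range_le_ker_iff, Matrix.mul_sub, Matrix.mul_one, sub_eq_zero]
      have := congrArg Matrix.conjTranspose (projRange_mul_self A)
      rw [Matrix.conjTranspose_mul, projRange_herm] at this
      exact this.symm
  rw [hker, range_le_ker_iff]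

end MoorePenrose

/-! ### Algebra of the sums `T̃_m`. -/

section TTilde

variable {t s : ℕ} (T : Matrix (Fin t) (Fin t) ℂ) (S : Matrix (Fin t) (Fin s) ℂ)
  (N : Matrix (Fin s) (Fin s) ℂ)

theorem tTilde_succ (m : ℕ) : tTilde T S N (m + 1) = T ^ m * S + tTilde T S N m * N := by
  unfold tTilde
  rw [Finset.sum_range_succ, Matrix.sum_mul, add_comm]
  congr 1
  · simp
  · refine Finset.sum_congr rfl fun i hi => ?_
    have := Finset.mem_range.mp hi
    rw [Matrix.mul_assoc _ _ N, ← pow_succ]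
    congr 2
    omega

theorem tTilde_succ' (m : ℕ) : tTilde T S N (m + 1) = T * tTilde T S N m + S * N ^ m := by
  unfold tTilde
  rw [Finset.sum_range_succ', Matrix.mul_sum]
  congr 1
  · refine Finset.sum_congr rfl fun i _ => ?_
    rw [pow_succ', Matrix.mul_assoc T, Matrix.mul_assoc T, Nat.add_sub_cancel, Nat.sub_sub,
      add_comm 1 i]
  · simp

theorem fromBlocks_pow (m : ℕ) :
    Matrix.fromBlocks T S 0 N ^ m = Matrix.fromBlocks (T ^ m) (tTilde T S N m) 0 (N ^ m) := by
  induction m with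
  | zero => simp [tTilde, Matrix.fromBlocks_one]
  | succ m ih =>
    rw [pow_succ, ih, Matrix.fromBlocks_multiply, tTilde_succ]
    simp [pow_succ]

variable {T S N}

/-- Each summand becomes `T^i S N^(r+j)`, which contains the factor `S N^j`. -/
theorem tTilde_mul_pow_eq_zero {j : ℕ} (h : S * N ^ j = 0) (m : ℕ) :
    tTilde T S N m * N ^ j = 0 := by
  induction m with
  | zero => simp [tTilde]
  | succ m ih =>
    rw [tTilde_succ', Matrix.add_mul, Matrix.mul_assoc, ih, Matrix.mul_assoc, ← pow_add,
      add_comm m j, pow_add, ← Matrix.mul_assoc, h, Matrix.mul_zero, Matrix.zero_mul, add_zero]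

theorem eq_zero_of_pow_mul {V : Matrix (Fin t) (Fin t) ℂ} (hV : V * T = 1) {m : ℕ}
    {X : Matrix (Fin t) (Fin s) ℂ} (h : T ^ m * X = 0) : X = 0 := by
  induction m with
  | zero => simpa using h
  | succ m ih =>
    refine ih ?_
    rw [← Matrix.one_mul (T ^ m * X), ← hV, Matrix.mul_assoc, ← Matrix.mul_assoc T, ← pow_succ',
      h, Matrix.mul_zero]

/-- Only the summands with `N^0` and `N^1` survive. -/
theorem tTilde_add_two (h : S * N ^ 2 = 0) (m : ℕ) :
    tTilde T S N (m + 2) = T ^ m * (T * S + S * N) := by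
  rw [tTilde_succ, tTilde_succ, Matrix.add_mul, Matrix.mul_assoc _ N N, ← sq, tTilde_mul_pow_eq_zero h, add_zero,
    pow_succ, Matrix.mul_add]
  simp only [Matrix.mul_assoc]

/-- If `T` is left invertible and `N` is nilpotent, then `T̃_(m+1) N² = 0` forces `S N² = 0`. -/
theorem mul_sq_eq_zero_of_tTilde {V : Matrix (Fin t) (Fin t) ℂ} (hV : V * T = 1)
    (hN : IsNilpotent N) {m : ℕ} (h : tTilde T S N (m + 1) * N ^ 2 = 0) : S * N ^ 2 = 0 := by
  obtain ⟨k, hk⟩ := hN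
  -- If `S N^(j+3) = 0`, the only summand left in `T̃_(m+1) N^(j+2)` is `T^m S N^(j+2)`, and `T^m`
  -- cancels.
  have step : ∀ j, S * N ^ (j + 3) = 0 → S * N ^ (j + 2) = 0 := by
    intro j hj
    have h1 : tTilde T S N (m + 1) * N ^ (j + 2) = 0 := by
      rw [add_comm j 2, pow_add, ← Matrix.mul_assoc, h, Matrix.zero_mul]
    rw [tTilde_succ, Matrix.add_mul, Matrix.mul_assoc _ N, ← pow_succ',
      tTilde_mul_pow_eq_zero hj, add_zero,
      Matrix.mul_assoc] at h1
    exact eq_zero_of_pow_mul hV h1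
  have desc : ∀ j, S * N ^ (j + 2) = 0 → S * N ^ 2 = 0 := by
    intro j
    induction j with
    | zero => exact id
    | succ j ih => exact fun h => ih (step j h)
  exact desc k (by rw [pow_add, hk]; simp)

/-- The block form of the commutation of `A ^ (m + 1)` with the WC inverse of `A` does not
depend on `m`. -/
theorem tTilde_comm_iff {V : Matrix (Fin t) (Fin t) ℂ} (hV : V * T = 1) (hN : IsNilpotent N)
    (m : ℕ) :
    T ^ (m + 1) * S * projRange N = tTilde T S N (m + 2) ↔
      S * N + T * S * (1 - projRange N) = 0 := by
  have hPN : (1 - projRange N) * N = 0 := by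
    rw [Matrix.sub_mul, projRange_mul_self, Matrix.one_mul, sub_self]
  have key : S * N ^ 2 = 0 → tTilde T S N (m + 2) - T ^ (m + 1) * S * projRange N =
      T ^ m * (S * N + T * S * (1 - projRange N)) := by
    intro h
    rw [tTilde_add_two h, pow_succ]
    simp only [Matrix.mul_add, Matrix.mul_sub, Matrix.mul_one, Matrix.mul_assoc]
    abel
  constructor
  · intro h
    -- After right multiplication by `N`, `P_N N = N` makes the leading terms `T^(m+1) S N` cancel.
    have h1 : tTilde T S N (m + 1) * N ^ 2 = 0 := by
      have h2 := congrArg (· * N) h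
      simp only [Matrix.mul_assoc, projRange_mul_self] at h2
      rw [tTilde_succ, Matrix.add_mul, Matrix.mul_assoc, Matrix.mul_assoc, ← sq] at h2
      exact left_eq_add.mp h2
    have hS := mul_sq_eq_zero_of_tTilde hV hN h1
    have h3 := key hS
    rw [h, sub_self] at h3
    exact eq_zero_of_pow_mul hV h3.symm
  · intro h
    have hS : S * N ^ 2 = 0 := by
      have h2 := congrArg (· * N) h
      simpa [Matrix.add_mul, Matrix.mul_assoc, hPN, ← sq] using h2
    have h3 := key hS
    rw [h, Matrix.mul_zero] at h3
    exact (sub_eq_zero.mp h3).symm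

/-- The range and null space form of `S N + T S (1 - P_N) = 0`. -/
theorem tTilde_null_iff {V : Matrix (Fin t) (Fin t) ℂ} (hV : V * T = 1) {k : ℕ}
    (hN : N ^ (k + 1) = 0) :
    (S * N ^ 2 = 0 ∧ tTilde T S N (k + 1) * (1 - projRange N) = 0) ↔
      S * N + T * S * (1 - projRange N) = 0 := by
  have hPN : (1 - projRange N) * N = 0 := by
    rw [Matrix.sub_mul, projRange_mul_self, Matrix.one_mul, sub_self]
  have hPP : (1 - projRange N) * projRange N = 0 := by
    rw [Matrix.sub_mul, projRange_idem, Matrix.one_mul, sub_self]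
  -- The nilpotency exponent is `k + 1` here, so the extra term `S N^(k+1)` of the recursion
  -- vanishes.
  have hTt : T * tTilde T S N (k + 1) = tTilde T S N (k + 2) := by
    rw [tTilde_succ' T S N (k + 1), hN, Matrix.mul_zero, add_zero]
  have key : S * N ^ 2 = 0 → tTilde T S N (k + 2) * (1 - projRange N) =
      T ^ k * (S * N + T * S * (1 - projRange N)) := by
    intro h
    have hSP : S * N * projRange N = 0 := by
      unfold projRange
      rw [← Matrix.mul_assoc, Matrix.mul_assoc S, ← sq, h, Matrix.zero_mul]
    rw [tTilde_add_two h, Matrix.mul_assoc, Matrix.add_mul, Matrix.mul_sub (S * N), hSP, sub_zero,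
      Matrix.mul_one, add_comm]
  constructor
  · rintro ⟨h1, h2⟩
    refine eq_zero_of_pow_mul hV (m := k) ?_
    rw [← key h1, ← hTt, Matrix.mul_assoc, h2, Matrix.mul_zero]
  · intro h
    have hS : S * N ^ 2 = 0 := by
      have h2 := congrArg (· * N) h
      simpa [Matrix.add_mul, Matrix.mul_assoc, hPN, ← sq] using h2
    refine ⟨hS, eq_zero_of_pow_mul hV (m := 1) ?_⟩
    rw [pow_one, ← Matrix.mul_assoc, hTt, key hS, h, Matrix.mul_zero]

end TTilde

/-! ### Block forms of the generalized inverses. -/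

section BlockForm

variable {n : Type*} [Fintype n] {t s : ℕ}
  (φ : Matrix (Fin t ⊕ Fin s) (Fin t ⊕ Fin s) ℂ ≃⋆ₐ[ℂ] Matrix n n ℂ)
  {T V : Matrix (Fin t) (Fin t) ℂ} {S : Matrix (Fin t) (Fin s) ℂ} {N : Matrix (Fin s) (Fin s) ℂ}

theorem projRange_block (hTV : T * V = 1) :
    projRange (φ (Matrix.fromBlocks T S 0 N)) = φ (Matrix.fromBlocks 1 0 0 (projRange N)) := by
  -- The corner `-V S N†` is chosen so that `T(-V S N†) + S N† = 0`, leaving `diag(1, P_N)`.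
  refine eq_projRange (Y := φ (Matrix.fromBlocks V (-(V * S * pinv N)) 0 (pinv N))) ?_ ?_ ?_
  · rw [← Matrix.star_eq_conjTranspose, ← map_star, Matrix.star_eq_conjTranspose,
      Matrix.fromBlocks_conjTranspose, projRange_herm]
    simp
  · rw [← map_mul, Matrix.fromBlocks_multiply]
    simp [projRange_mul_self]
  · rw [← map_mul, Matrix.fromBlocks_multiply]
    simp [projRange, hTV, Matrix.mul_neg, ← Matrix.mul_assoc]

variable [DecidableEq n]

/-- Since `N^k = 0`, `A^k` is `diag(V, 0)` times `A^(k+1)`. The core EP inverse is thus `diag(V, 0)`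
times the projector onto the range of `A^(k+1)`, which is the first block. -/
theorem coreEP_block (hTV : T * V = 1) (hN : N ^ ind (φ (Matrix.fromBlocks T S 0 N)) = 0) :
    coreEP (φ (Matrix.fromBlocks T S 0 N)) = φ (Matrix.fromBlocks V 0 0 0) := by
  unfold coreEP
  set k := ind (φ (Matrix.fromBlocks T S 0 N))
  have hVT : V * T = 1 := mul_eq_one_comm.mp hTV
  have hN' : N ^ (k + 1) = 0 := by rw [pow_succ, hN, zero_mul]
  have hpow : T ^ (k + 1) * V ^ (k + 1) = 1 := by
    rw [← (show Commute T V from hTV.trans hVT.symm).mul_pow, hTV, one_pow]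
  have hP : projRange (φ (Matrix.fromBlocks T S 0 N) ^ (k + 1)) =
      φ (Matrix.fromBlocks 1 0 0 0) := by
    refine eq_projRange (Y := φ (Matrix.fromBlocks (V ^ (k + 1)) 0 0 0)) ?_ ?_ ?_
    · rw [← Matrix.star_eq_conjTranspose, ← map_star, Matrix.star_eq_conjTranspose,
        Matrix.fromBlocks_conjTranspose]
      simp
    · rw [← map_pow, fromBlocks_pow, hN', ← map_mul, Matrix.fromBlocks_multiply]
      simp
    · rw [← map_pow, fromBlocks_pow, ← map_mul, Matrix.fromBlocks_multiply]
      simp [hpow]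
  have hA : φ (Matrix.fromBlocks T S 0 N) ^ k =
      φ (Matrix.fromBlocks V 0 0 0) * φ (Matrix.fromBlocks T S 0 N) ^ (k + 1) := by
    rw [← map_pow, ← map_pow, fromBlocks_pow, fromBlocks_pow, ← map_mul,
      Matrix.fromBlocks_multiply, tTilde_succ', hN, pow_succ' T, ← Matrix.mul_assoc V, hVT,
      Matrix.mul_zero S, add_zero, ← Matrix.mul_assoc V T (tTilde T S N k), hVT]
    simp
  rw [hA, Matrix.mul_assoc]
  change _ * projRange _ = _
  rw [hP, ← map_mul, Matrix.fromBlocks_multiply]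
  simp

theorem weakCore_block (hTV : T * V = 1) (hN : N ^ ind (φ (Matrix.fromBlocks T S 0 N)) = 0) :
    weakCore (φ (Matrix.fromBlocks T S 0 N)) =
      φ (Matrix.fromBlocks V (V * V * S * projRange N) 0 0) := by
  have hVT : V * T = 1 := mul_eq_one_comm.mp hTV
  rw [weakCore, weakGroup, coreEP_block φ hTV hN, projRange_block φ hTV, sq, ← map_mul, ← map_mul,
    ← map_mul, Matrix.fromBlocks_multiply, Matrix.fromBlocks_multiply, Matrix.fromBlocks_multiply]
  simp [Matrix.mul_assoc, hVT]

theorem pow_mul_weakCore_block_iff (hTV : T * V = 1)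
    (hN : N ^ ind (φ (Matrix.fromBlocks T S 0 N)) = 0) (m : ℕ) :
    φ (Matrix.fromBlocks T S 0 N) ^ (m + 1) * weakCore (φ (Matrix.fromBlocks T S 0 N)) =
      weakCore (φ (Matrix.fromBlocks T S 0 N)) * φ (Matrix.fromBlocks T S 0 N) ^ (m + 1) ↔
      T ^ (m + 1) * S * projRange N = tTilde T S N (m + 2) := by
  have hVT : V * T = 1 := mul_eq_one_comm.mp hTV
  have hcomm : Commute T V := hTV.trans hVT.symm
  have hPN : projRange N * N ^ (m + 1) = N ^ (m + 1) := by
    rw [pow_succ', ← mul_assoc, projRange_mul_self]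
  -- Both upper right blocks are written with the left factor `V * V`, removed at the end by
  -- multiplying twice by `T`.
  have e1 : T ^ (m + 1) * (V * V * S * projRange N) =
      V * V * (T ^ (m + 1) * S * projRange N) := by
    have := ((hcomm.mul_right hcomm).pow_left (m + 1)).eq
    simp only [← Matrix.mul_assoc] at this ⊢
    rw [this]
  have e2 : V * tTilde T S N (m + 1) + V * V * S * projRange N * N ^ (m + 1) =
      V * V * tTilde T S N (m + 2) := by
    rw [tTilde_succ' T S N (m + 1), Matrix.mul_add, Matrix.mul_assoc _ (projRange N), hPN]
    simp only [Matrix.mul_assoc]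
    rw [← Matrix.mul_assoc V T, hVT, Matrix.one_mul]
  rw [weakCore_block φ hTV hN, ← map_pow, ← map_mul, ← map_mul, (EquivLike.injective φ).eq_iff,
    fromBlocks_pow, Matrix.fromBlocks_multiply, Matrix.fromBlocks_multiply, Matrix.fromBlocks_inj]
  simp only [Matrix.mul_zero, Matrix.zero_mul, add_zero, and_true]
  rw [e1, e2, (hcomm.pow_left (m + 1)).eq]
  refine ⟨fun h => ?_, fun h => ⟨rfl, by rw [h]⟩⟩
  have h1 := congrArg (fun X => T * (T * X)) h.2
  simp only [← Matrix.mul_assoc] at h1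
  rw [Matrix.mul_assoc T T V, hTV, Matrix.mul_one, hTV] at h1
  simpa using h1

/-- A WC inverse that commutes with the matrix is its Drazin inverse. -/
theorem isDrazin_weakCore_block (hTV : T * V = 1)
    (hN : N ^ ind (φ (Matrix.fromBlocks T S 0 N)) = 0)
    (h : φ (Matrix.fromBlocks T S 0 N) * weakCore (φ (Matrix.fromBlocks T S 0 N)) =
      weakCore (φ (Matrix.fromBlocks T S 0 N)) * φ (Matrix.fromBlocks T S 0 N)) :
    IsDrazin (φ (Matrix.fromBlocks T S 0 N)) (weakCore (φ (Matrix.fromBlocks T S 0 N))) := by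
  have hVT : V * T = 1 := mul_eq_one_comm.mp hTV
  -- Commutation is the hypothesis; the other two Drazin equations follow from the block form alone.
  refine ⟨?_, h, ?_⟩
  · rw [weakCore_block φ hTV hN, ← map_mul, ← map_mul, Matrix.fromBlocks_multiply,
      Matrix.fromBlocks_multiply]
    simp [hVT]
  · rw [weakCore_block φ hTV hN]
    set k := ind (φ (Matrix.fromBlocks T S 0 N))
    rw [← map_pow, ← map_pow, ← map_mul, fromBlocks_pow, fromBlocks_pow,
      Matrix.fromBlocks_multiply, tTilde_succ', pow_succ N, hN, pow_succ' T, ← Matrix.mul_assoc V,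
      hVT, Matrix.mul_zero S, add_zero, ← Matrix.mul_assoc V T (tTilde T S N k), hVT]
    simp

end BlockForm

/-- Reindexing along `e` followed by conjugation with a unitary `U`. -/
noncomputable def unitaryReindex {m n : Type*} [Fintype m] [DecidableEq m] [Fintype n]
    [DecidableEq n] (e : m ≃ n) (U : Matrix.unitaryGroup n ℂ) :
    Matrix m m ℂ ≃⋆ₐ[ℂ] Matrix n n ℂ :=
  (StarAlgEquiv.ofAlgEquiv (Matrix.reindexAlgEquiv ℂ ℂ e) fun M => by
    simp [Matrix.star_eq_conjTranspose, Matrix.conjTranspose_submatrix]).trans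
    (Unitary.conjStarAlgAut ℂ _ U)

theorem unitaryReindex_apply {m n : Type*} [Fintype m] [DecidableEq m] [Fintype n]
    [DecidableEq n] (e : m ≃ n) (U : Matrix.unitaryGroup n ℂ) (M : Matrix m m ℂ) :
    unitaryReindex e U M = (U : Matrix n n ℂ) * Matrix.reindex e e M * (U : Matrix n n ℂ)ᴴ :=
  rfl

theorem weakCore_mul_projRange {n : Type*} [Fintype n] [DecidableEq n] (A : Matrix n n ℂ) :
    weakCore A * projRange A = weakCore A := by
  rw [weakCore, mul_assoc, projRange_idem]

end WeakCore

/-! ### The equivalence of the seven conditions. -/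

open WeakCore
theorem theorem4p5 {n t k : ℕ} (ht : t ≤ n) (A U : Matrix (Fin n) (Fin n) ℂ)
    (T : Matrix (Fin t) (Fin t) ℂ) (S : Matrix (Fin t) (Fin (n - t)) ℂ)
    (N : Matrix (Fin (n - t)) (Fin (n - t)) ℂ)
    (hind : ind A = k) (hk : 1 ≤ k) (hA : IsCoreEPDecomposition ht k A U T S N) :
    List.TFAE [
      IsKWC A,
      ∀ m : ℕ, 1 ≤ m → A ^ m * weakCore A = weakCore A * A ^ m,
      ∃ m : ℕ, 1 ≤ m ∧ A ^ m * weakCore A = weakCore A * A ^ m,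
      weakCore A = drazin A,
      IsWC A ∧ IsKDMP A,
      LinearMap.range (N ^ 2).mulVecLin ≤ LinearMap.ker S.mulVecLin ∧
        LinearMap.ker (Nᴴ).mulVecLin ≤ LinearMap.ker (tTilde T S N k).mulVecLin,
      S * N + T * S * (1 - projRange N) = 0] := by
  obtain ⟨V, hTV⟩ := hA.nonsingular.exists_right_inv
  have hVT : V * T = 1 := mul_eq_one_comm.mp hTV
  have hNk : N ^ k = 0 := hA.nilpotent_index ▸ pow_nilpotencyClass hA.nilpotent
  set φ := unitaryReindex (blockEquiv ht) ⟨U, hA.unitary⟩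
  have hAφ : A = φ (Matrix.fromBlocks T S 0 N) := by
    rw [unitaryReindex_apply]
    exact hA.eq
  have hN : N ^ ind (φ (Matrix.fromBlocks T S 0 N)) = 0 := by rw [← hAφ, hind, hNk]
  have hcomm : ∀ m : ℕ, 1 ≤ m → (A ^ m * weakCore A = weakCore A * A ^ m ↔
      S * N + T * S * (1 - projRange N) = 0) := by
    intro m hm
    -- The block criterion is stated for exponents `m + 1`, because the zeroth power commutes
    -- trivially.
    obtain ⟨m, rfl⟩ := Nat.exists_eq_add_of_le' hm
    rw [hAφ, pow_mul_weakCore_block_iff φ hTV hN, tTilde_comm_iff hVT hA.nilpotent]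
  have hdrazin : A * weakCore A = weakCore A * A → weakCore A = drazin A := by
    intro h
    refine IsDrazin.unique (A := A) ?_ (drazin_spec A)
    rw [hAφ] at h ⊢
    exact isDrazin_weakCore_block φ hTV hN h
  tfae_have 1 ↔ 7 := by
    rw [IsKWC, hind]
    exact hcomm k hk
  tfae_have 7 → 2 := fun h m hm => (hcomm m hm).mpr h
  tfae_have 2 → 3 := fun h => ⟨1, le_rfl, h 1 le_rfl⟩
  tfae_have 3 → 7 := fun ⟨m, hm, h⟩ => (hcomm m hm).mp h
  tfae_have 2 → 4 := fun h => hdrazin (by simpa using h 1 le_rfl)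
  tfae_have 4 → 5 := by
    intro h
    -- Replacing `A^d` by the WC inverse in `A^d P_A` changes nothing further, as the WC inverse
    -- absorbs `P_A` on the right.
    have hW : weakCore A = dmp A := by rw [dmp, ← h, weakCore_mul_projRange]
    refine ⟨hW, ?_⟩
    rw [IsKDMP, ← hW, h]
    exact ((show Commute A (drazin A) from (drazin_spec A).comm).pow_left _).eq
  tfae_have 5 → 1 := by
    rintro ⟨hW, hD⟩
    rw [IsKWC, show weakCore A = dmp A from hW]
    exact hD
  tfae_have 6 ↔ 7 := by
    obtain ⟨j, rfl⟩ := Nat.exists_eq_add_of_le' hk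
    rw [range_le_ker_iff, ker_conjTranspose_le_ker_iff]
    exact tTilde_null_iff hVT hNk
  tfae_finish
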